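/- Let $m\ge 2$, let $S^m$ be the unit sphere of $\mathbb{R}^{m+1}$ and let $\cdot$ denote the Euclidean inner product. A real kernel $K$ on a nonempty set $X$ is positive definite if $K(x,y)=K(y,x)$ for all $x,y\in X$ and $\sum_{\mu,\nu=1}^n c_\mu c_\nu K(x_\mu,x_\nu)\ge 0$ for all $n\ge 1$, all distinct $x_1,\dots,x_n\in X$ and all $c_1,\dots,c_n\in\mathbb{R}$; it is strictly positive definite if, moreover, the inequality is strict whenever some $c_\mu\neq 0$. For $d\ge 2$ let $P_n^d$ be the Gegenbauer polynomial of degree $n$ with parameter $(d-1)/2$, normalized by $P_n^d(1)=\binom{n+d-2}{n}$; let $P_0^1=1$ and $P_n^1(\cos\theta)=\frac{2}{n}\cos n\theta$ for $n\ge 1$. For $d\ge1$, a set $I\subseteq\mathbb{Z}_+=\{0,1,2,\dots\}$ belongs to $\mathrm{SPD}(S^d)$ if there is a continuous function $g:[-1,1]\to\mathbb{R}$ such that the kernel $(z,w)\mapsto g(z\cdot w)$ on $S^d$ is strictly positive definite and $I=\{l : a_l^d>0\}$, where $g(t)=\sum_{l\ge 0} a_l^d P_l^d(t)$ $(t\in[-1,1])$,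 with $a_l^d\ge 0$ and $\sum_l a_l^dP_l^d(1)<\infty$, is the Schoenberg series representation of $g$. Let $f:[-1,1]^2\to\mathbb{R}$ be continuous and such that the kernel $((x,z),(y,w))\mapsto f(x\cdot y,z\cdot w)$ on $S^1\times S^m$ is positive definite, and consider its series representation $$f(t,s)=\sum_{k,l=0}^\infty a_{k,l}^{1,m}P_k^1(t)P_l^m(s),\qquad t,s\in[-1,1],$$ where $a_{k,l}^{1,m}\ge 0$ and $\sum_{k,l}a_{k,l}^{1,m}P_k^1(1)P_l^m(1)<\infty$. If $$\big\{k : \{l : a_{k,l}^{1,m}>0\}\in \mathrm{SPD}(S^m)\big\}\in \mathrm{SPD}(S^1),$$ then the kernel $((x,z),(y,w))\mapsto f(x\cdot y,z\cdot w)$ is strictly positive definite on $S^1\times S^m$. -/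

import Mathlib

namespace SphereKernel

/-- The unit sphere `S^m` of the Euclidean space `ℝ^(m+1)`. -/
abbrev Sphere (m : ℕ) : Type :=
  Metric.sphere (0 : EuclideanSpace ℝ (Fin (m + 1))) 1

/-- The inner product of `ℝ^(m+1)` applied to two points of `S^m`. -/
noncomputable def dot {m : ℕ} (x y : Sphere m) : ℝ :=
  inner ℝ (x : EuclideanSpace ℝ (Fin (m + 1))) (y : EuclideanSpace ℝ (Fin (m + 1)))

/-- A real kernel is positive definite: it is symmetric and every quadratic form at finitely many
distinct points is nonnegative. -/
def IsPosDefKernel {X : Type*} (K : X → X → ℝ) : Prop :=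
  (∀ x y, K x y = K y x) ∧
    ∀ (n : ℕ) (x : Fin n → X), Function.Injective x → ∀ c : Fin n → ℝ,
      0 ≤ ∑ μ, ∑ ν, c μ * c ν * K (x μ) (x ν)

/-- A positive definite kernel is strictly positive definite if the quadratic forms at distinct
points are positive whenever at least one of the coefficients is nonzero. -/
def IsStrictPosDefKernel {X : Type*} (K : X → X → ℝ) : Prop :=
  IsPosDefKernel K ∧
    ∀ (n : ℕ) (x : Fin n → X), Function.Injective x → ∀ c : Fin n → ℝ, (∃ μ, c μ ≠ 0) →
      0 < ∑ μ, ∑ ν, c μ * c ν * K (x μ) (x ν)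

/-- The Gegenbauer polynomial `C_n^lam`, by the classical three-term recurrence
`(n+2) C_{n+2} = 2 (n+1+lam) t C_{n+1} - (n + 2 lam) C_n`. -/
noncomputable def gegenbauer (lam : ℝ) : ℕ → Polynomial ℝ
  | 0 => 1
  | 1 => Polynomial.C (2 * lam) * Polynomial.X
  | n + 2 =>
      Polynomial.C (1 / ((n : ℝ) + 2)) *
        (Polynomial.C (2 * ((n : ℝ) + 1 + lam)) * Polynomial.X * gegenbauer lam (n + 1) -
          Polynomial.C ((n : ℝ) + 2 * lam) * gegenbauer lam n)

/-- The polynomial `P_n^m` attached to `S^m`: the Gegenbauer polynomial with parameter `(m-1)/2`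
if `m ≥ 2`, and for `m = 1` the limit case `P_0^1 = 1`, `P_n^1(cos θ) = (2/n) cos (n θ)`. -/
noncomputable def sphPoly (m n : ℕ) : Polynomial ℝ :=
  if m = 1 then
    (if n = 0 then 1 else Polynomial.C (2 / (n : ℝ)) * Polynomial.Chebyshev.T ℝ (n : ℤ))
  else gegenbauer (((m : ℝ) - 1) / 2) n

/-- `g(t) = ∑ a_n P_n^m(t)` on `[-1,1]` with `a_n ≥ 0` and `∑ a_n P_n^m(1) < ∞`. -/
def IsSchoenbergSeries (m : ℕ) (g : ℝ → ℝ) (a : ℕ → ℝ) : Prop :=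
  (∀ n, 0 ≤ a n) ∧
    Summable (fun n => a n * (sphPoly m n).eval 1) ∧
    ∀ t ∈ Set.Icc (-1 : ℝ) 1, HasSum (fun n => a n * (sphPoly m n).eval t) (g t)

/-- `f(t,s) = ∑ a_{k,l} P_k^m(t) P_l^M(s)` on `[-1,1]²` with `a_{k,l} ≥ 0` and
`∑ a_{k,l} P_k^m(1) P_l^M(1) < ∞`. -/
def IsSchoenbergDoubleSeries (m M : ℕ) (f : ℝ → ℝ → ℝ) (a : ℕ → ℕ → ℝ) : Prop :=
  (∀ k l, 0 ≤ a k l) ∧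
    Summable (fun p : ℕ × ℕ =>
      a p.1 p.2 * (sphPoly m p.1).eval 1 * (sphPoly M p.2).eval 1) ∧
    ∀ t ∈ Set.Icc (-1 : ℝ) 1, ∀ s ∈ Set.Icc (-1 : ℝ) 1,
      HasSum (fun p : ℕ × ℕ =>
        a p.1 p.2 * (sphPoly m p.1).eval t * (sphPoly M p.2).eval s) (f t s)

/-- `SPD m` is the collection of the index sets `{l | a_l > 0}` of the continuous isotropic
strictly positive definite kernels `(z, w) ↦ g (z · w)` on `S^m`. -/
def SPD (m : ℕ) : Set (Set ℕ) :=
  {I | ∃ (g : ℝ → ℝ) (a : ℕ → ℝ),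
    ContinuousOn g (Set.Icc (-1 : ℝ) 1) ∧
    IsStrictPosDefKernel (fun z w : Sphere m => g (dot z w)) ∧
    IsSchoenbergSeries m g a ∧ {l | 0 < a l} = I}

/-- The isotropic kernel `((x, z), (y, w)) ↦ f (x · y, z · w)` on `S^m × S^M`. -/
noncomputable def productKernel (m M : ℕ) (f : ℝ → ℝ → ℝ) :
    Sphere m × Sphere M → Sphere m × Sphere M → ℝ :=
  fun p q => f (dot p.1 q.1) (dot p.2 q.2)

end SphereKernel

/-! Suppose the quadratic form of the product kernel vanishes at distinct points `(x_μ, z_μ)` with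
coefficients `c`. On the circle `P_k^1(x · y) = β (u x * u y + v x * v y)`, so the `(k, l)` term is
`a k l * β k` times the sum of two quadratic forms of `P_l^m`, with coefficients `c u_k` and `c
v_k`. All terms are nonnegative, hence each one vanishes. Strictness on `S^m` makes `c u_k` and `c
v_k` sum to zero over each fiber of `z` for every admissible `k`; strictness on `S^1` then isolates
a single coefficient. The one analytic input, positive definiteness of `P_l^m`, is proved
algebraically: `P_l^m(y · z)` is, up to a positive constant, a Fischer inner product of harmonic
polynomials. -/

namespace SphereKernel

open MvPolynomial

/-! ### Fischer inner product and adjoint differential operators -/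

section Fischer

variable {σ : Type*} [Fintype σ]

/-- The Fischer inner product on polynomials, for which the monomials are orthogonal and
`X^a` has squared norm `a!`. -/
noncomputable def fischer : MvPolynomial σ ℝ →ₗ[ℝ] MvPolynomial σ ℝ →ₗ[ℝ] ℝ :=
  (basisMonomials σ ℝ).constr ℝ fun a => ((∏ i, (a i).factorial : ℕ) : ℝ) • lcoeff ℝ a

theorem fischer_monomial (a : σ →₀ ℕ) (c : ℝ) (q : MvPolynomial σ ℝ) :
    fischer (monomial a c) q = c * ((∏ i, (a i).factorial : ℕ) : ℝ) * coeff a q := by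
  have h : monomial a c = c • basisMonomials σ ℝ a := by
    simp [smul_monomial]
  rw [h, map_smul, fischer, Module.Basis.constr_basis]
  simp [lcoeff_apply, mul_assoc]

theorem fischer_self_nonneg (p : MvPolynomial σ ℝ) : 0 ≤ fischer p p := by
  have h : fischer p p =
      ∑ a ∈ p.support, fischer (monomial a (coeff a p)) p := by
    rw [← LinearMap.sum_apply, ← map_sum, ← p.as_sum]
  rw [h]
  refine Finset.sum_nonneg fun a _ => ?_
  rw [fischer_monomial]
  nlinarith [mul_nonneg (mul_self_nonneg (coeff a p))
    (Nat.cast_nonneg (α := ℝ) (∏ i, (a i).factorial))]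

theorem fischer_X_mul (i : σ) (p q : MvPolynomial σ ℝ) :
    fischer (X i * p) q = fischer p (pderiv i q) := by
  classical
  induction p using MvPolynomial.induction_on' with
  | monomial a c =>
    rw [X, monomial_mul, fischer_monomial, fischer_monomial, coeff_pderiv, add_comm a]
    have h : (∏ j, ((Finsupp.single i 1 + a : σ →₀ ℕ) j).factorial) =
        (a i + 1) * ∏ j, (a j).factorial := by
      rw [← Finset.mul_prod_erase _ _ (Finset.mem_univ i),
        ← Finset.mul_prod_erase _ (fun j => (a j).factorial) (Finset.mem_univ i)]
      have h' : ∀ j ∈ Finset.univ.erase i,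
          ((Finsupp.single i 1 + a : σ →₀ ℕ) j).factorial = (a j).factorial := by
        intro j hj
        simp [(Finset.ne_of_mem_erase hj).symm]
      rw [Finset.prod_congr rfl h']
      simp [add_comm 1, Nat.factorial_succ, mul_assoc]
    rw [h]
    push_cast
    ring
  | add p q hp hq => simp only [mul_add, map_add, LinearMap.add_apply, hp, hq]

/-- The linear form `x ↦ ∑ y_i x_i`. -/
noncomputable def linForm (y : σ → ℝ) : MvPolynomial σ ℝ := ∑ i, C (y i) * X i

/-- The quadratic form `x ↦ ∑ x_i ^ 2`. -/
noncomputable def normSqForm (σ : Type*) [Fintype σ] : MvPolynomial σ ℝ := ∑ i, X i * X i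

/-- The derivative in direction `y`. -/
noncomputable def dirDeriv (y : σ → ℝ) (p : MvPolynomial σ ℝ) : MvPolynomial σ ℝ :=
  ∑ i, C (y i) * pderiv i p

/-- The Laplace operator. -/
noncomputable def laplacian (p : MvPolynomial σ ℝ) : MvPolynomial σ ℝ := ∑ i, pderiv i (pderiv i p)

theorem dirDeriv_sub (y : σ → ℝ) (p q : MvPolynomial σ ℝ) :
    dirDeriv y (p - q) = dirDeriv y p - dirDeriv y q := by
  simp [dirDeriv, mul_sub, Finset.sum_sub_distrib]

theorem dirDeriv_mul (y : σ → ℝ) (p q : MvPolynomial σ ℝ) :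
    dirDeriv y (p * q) = dirDeriv y p * q + p * dirDeriv y q := by
  simp only [dirDeriv, Finset.mul_sum, Finset.sum_mul, ← Finset.sum_add_distrib, pderiv_mul]
  exact Finset.sum_congr rfl fun i _ => by ring

theorem dirDeriv_C_mul (y : σ → ℝ) (c : ℝ) (p : MvPolynomial σ ℝ) :
    dirDeriv y (C c * p) = C c * dirDeriv y p := by
  simp only [dirDeriv, pderiv_C_mul, Finset.mul_sum]
  exact Finset.sum_congr rfl fun i _ => by ring

theorem fischer_linForm_mul (y : σ → ℝ) (p q : MvPolynomial σ ℝ) :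
    fischer (linForm y * p) q = fischer p (dirDeriv y q) := by
  rw [dirDeriv, linForm, Finset.sum_mul, map_sum, map_sum, LinearMap.sum_apply]
  refine Finset.sum_congr rfl fun i _ => ?_
  rw [mul_assoc, ← smul_eq_C_mul, ← smul_eq_C_mul, map_smul, map_smul, LinearMap.smul_apply,
    fischer_X_mul]

theorem fischer_normSqForm_mul (p q : MvPolynomial σ ℝ) :
    fischer (normSqForm σ * p) q = fischer p (laplacian q) := by
  rw [normSqForm, laplacian, Finset.sum_mul, map_sum, map_sum, LinearMap.sum_apply]
  refine Finset.sum_congr rfl fun i _ => ?_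
  rw [mul_assoc, fischer_X_mul, fischer_X_mul]

theorem eval_dirDeriv_self {n : ℕ} {p : MvPolynomial σ ℝ} (hp : p.IsHomogeneous n) (y : σ → ℝ) :
    eval y (dirDeriv y p) = n * eval y p := by
  have h := congrArg (eval y) hp.sum_X_mul_pderiv
  simpa [dirDeriv] using h

theorem isHomogeneous_dirDeriv {n : ℕ} {p : MvPolynomial σ ℝ} (hp : p.IsHomogeneous n)
    (y : σ → ℝ) : (dirDeriv y p).IsHomogeneous (n - 1) := by
  rw [dirDeriv]
  refine IsHomogeneous.sum _ _ _ fun i _ => ?_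
  simpa using (isHomogeneous_C σ (y i)).mul (hp.pderiv (i := i))

/-- Reproducing property: each factor `linForm y` moves across as a derivative along `y`, which
Euler's identity evaluates at `y`. -/
theorem fischer_linForm_pow (y : σ → ℝ) (n : ℕ) (p : MvPolynomial σ ℝ) (hp : p.IsHomogeneous n) :
    fischer (linForm y ^ n) p = n.factorial * eval y p := by
  induction n generalizing p with
  | zero =>
    obtain ⟨c, rfl⟩ : ∃ c, p = C c :=
      ⟨_, totalDegree_eq_zero_iff_eq_C.mp ((totalDegree_zero_iff_isHomogeneous _).mpr hp)⟩
    have h : (1 : MvPolynomial σ ℝ) = monomial 0 1 := rfl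
    rw [pow_zero, h, fischer_monomial]
    simp
  | succ n ih =>
    rw [pow_succ', fischer_linForm_mul, ih _ (by simpa using isHomogeneous_dirDeriv hp y),
      eval_dirDeriv_self hp, Nat.factorial_succ]
    push_cast
    ring

theorem pderiv_linForm (y : σ → ℝ) (i : σ) : pderiv i (linForm y) = C (y i) := by
  classical
  simp only [linForm, map_sum, pderiv_C_mul, pderiv_X]
  rw [Finset.sum_eq_single i] <;> simp +contextual [eq_comm]

theorem pderiv_normSqForm (i : σ) : pderiv i (normSqForm σ) = 2 * X i := by
  classical
  simp only [normSqForm, map_sum, pderiv_mul, pderiv_X]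
  rw [Finset.sum_eq_single i] <;> simp +contextual [eq_comm, two_mul]

theorem dirDeriv_linForm (y : σ → ℝ) (hy : ∑ i, y i * y i = 1) : dirDeriv y (linForm y) = 1 := by
  simp only [dirDeriv, pderiv_linForm, ← C_mul, ← map_sum, hy, C_1]

theorem dirDeriv_normSqForm (y : σ → ℝ) : dirDeriv y (normSqForm σ) = 2 * linForm y := by
  simp only [dirDeriv, pderiv_normSqForm, linForm, Finset.mul_sum]
  exact Finset.sum_congr rfl fun i _ => by ring

theorem laplacian_sub (p q : MvPolynomial σ ℝ) :
    laplacian (p - q) = laplacian p - laplacian q := by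
  simp [laplacian, Finset.sum_sub_distrib]

theorem laplacian_C_mul (c : ℝ) (p : MvPolynomial σ ℝ) :
    laplacian (C c * p) = C c * laplacian p := by
  simp only [laplacian, pderiv_C_mul, Finset.mul_sum]

theorem laplacian_linForm_mul (y : σ → ℝ) (p : MvPolynomial σ ℝ) :
    laplacian (linForm y * p) = 2 * dirDeriv y p + linForm y * laplacian p := by
  simp only [laplacian, dirDeriv, Finset.mul_sum, ← Finset.sum_add_distrib]
  refine Finset.sum_congr rfl fun i _ => ?_
  simp only [pderiv_mul, pderiv_linForm, map_add, pderiv_C]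
  ring

theorem laplacian_normSqForm_mul {n : ℕ} {p : MvPolynomial σ ℝ} (hp : p.IsHomogeneous n) :
    laplacian (normSqForm σ * p) =
      C (2 * (Fintype.card σ : ℝ) + 4 * n) * p + normSqForm σ * laplacian p := by
  have h : laplacian (normSqForm σ * p) =
      ∑ i : σ, 2 * p + 4 * ∑ i, X i * pderiv i p + normSqForm σ * laplacian p := by
    simp only [laplacian, Finset.mul_sum, ← Finset.sum_add_distrib]
    refine Finset.sum_congr rfl fun i _ => ?_
    have h2 : pderiv i (2 : MvPolynomial σ ℝ) = 0 := by
      exact pderiv_C (R := ℝ) (a := 2) (i := i)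
    simp only [pderiv_mul, pderiv_normSqForm, map_add, pderiv_X_self, h2]
    ring
  rw [h, hp.sum_X_mul_pderiv]
  simp only [Finset.sum_const, Finset.card_univ, nsmul_eq_mul, map_add, map_mul, map_natCast]
  simp only [map_ofNat]
  ring

theorem dirDeriv_linForm_mul (y : σ → ℝ) (hy : ∑ i, y i * y i = 1) (p : MvPolynomial σ ℝ) :
    dirDeriv y (linForm y * p) = p + linForm y * dirDeriv y p := by
  rw [dirDeriv_mul, dirDeriv_linForm y hy, one_mul]

theorem dirDeriv_normSqForm_mul (y : σ → ℝ) (p : MvPolynomial σ ℝ) :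
    dirDeriv y (normSqForm σ * p) = 2 * linForm y * p + normSqForm σ * dirDeriv y p := by
  rw [dirDeriv_mul, dirDeriv_normSqForm]

end Fischer

end SphereKernel

namespace SphereKernel

open MvPolynomial

/-! ### Zonal harmonics and positive definiteness of `P_l^m` -/

section Zonal

variable {σ : Type*}

theorem isHomogeneous_C_mul {n : ℕ} {p : MvPolynomial σ ℝ} (c : ℝ) (hp : p.IsHomogeneous n) :
    (C c * p).IsHomogeneous n := by
  simpa using (isHomogeneous_C σ c).mul hp

theorem eq_of_C_mul_eq {c : ℝ} (hc : c ≠ 0) {p q : MvPolynomial σ ℝ} (h : C c * p = C c * q) :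
    p = q :=
  mul_left_cancel₀ (C_ne_zero.mpr hc) h

variable [Fintype σ]

/-- The homogeneous polynomial of degree `n` in `x` that restricts to
`x ↦ C_n^lam (x · y)` on the unit sphere. -/
noncomputable def zonal (lam : ℝ) (y : σ → ℝ) : ℕ → MvPolynomial σ ℝ
  | 0 => 1
  | 1 => C (2 * lam) * linForm y
  | n + 2 =>
      C (1 / ((n : ℝ) + 2)) *
        (C (2 * ((n : ℝ) + 1 + lam)) * (linForm y * zonal lam y (n + 1)) -
          C ((n : ℝ) + 2 * lam) * (normSqForm σ * zonal lam y n))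

theorem eval_linForm (x y : σ → ℝ) : eval x (linForm y) = ∑ i, y i * x i := by
  simp [linForm]

theorem eval_normSqForm (x : σ → ℝ) : eval x (normSqForm σ) = ∑ i, x i * x i := by
  simp [normSqForm]

theorem isHomogeneous_linForm (y : σ → ℝ) : (linForm y).IsHomogeneous 1 :=
  IsHomogeneous.sum _ _ _ fun i _ => by
    simpa using (isHomogeneous_C σ (y i)).mul (isHomogeneous_X ℝ i)

theorem isHomogeneous_normSqForm : (normSqForm σ).IsHomogeneous 2 :=
  IsHomogeneous.sum _ _ _ fun i _ => (isHomogeneous_X ℝ i).mul (isHomogeneous_X ℝ i)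

theorem isHomogeneous_zonal (lam : ℝ) (y : σ → ℝ) (n : ℕ) :
    (zonal lam y n).IsHomogeneous n := by
  induction n using Nat.twoStepInduction with
  | zero => exact isHomogeneous_one σ ℝ
  | one => exact isHomogeneous_C_mul _ (isHomogeneous_linForm y)
  | more n h0 h1 =>
    refine isHomogeneous_C_mul _ (IsHomogeneous.sub (isHomogeneous_C_mul _ ?_)
      (isHomogeneous_C_mul _ ?_))
    · convert (isHomogeneous_linForm y).mul h1 using 1
      omega
    · convert isHomogeneous_normSqForm.mul h0 using 1
      omega

theorem eval_zonal (lam : ℝ) (x y : σ → ℝ) (hx : ∑ i, x i * x i = 1) (n : ℕ) :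
    eval x (zonal lam y n) = (gegenbauer lam n).eval (∑ i, y i * x i) := by
  induction n using Nat.twoStepInduction with
  | zero => simp [zonal, gegenbauer]
  | one => simp [zonal, gegenbauer, eval_linForm]
  | more n h0 h1 =>
    simp only [zonal, gegenbauer, map_mul, map_sub, eval_C, Polynomial.eval_mul,
      Polynomial.eval_sub, Polynomial.eval_C, Polynomial.eval_X, h0, h1, eval_linForm,
      eval_normSqForm, hx]
    ring

theorem C_mul_zonal_add_two (lam : ℝ) (y : σ → ℝ) (n : ℕ) :
    C ((n : ℝ) + 2) * zonal lam y (n + 2) =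
      C (2 * ((n : ℝ) + 1 + lam)) * (linForm y * zonal lam y (n + 1)) -
        C ((n : ℝ) + 2 * lam) * (normSqForm σ * zonal lam y n) := by
  have h : ((n : ℝ) + 2) * (1 / ((n : ℝ) + 2)) = 1 := by
    field_simp
  rw [zonal, ← mul_assoc, ← C_mul, h, C_1, one_mul]

theorem dirDeriv_zonal (lam : ℝ) (y : σ → ℝ) (hy : ∑ i, y i * y i = 1) (n : ℕ) :
    dirDeriv y (zonal lam y (n + 1)) = C ((n : ℝ) + 2 * lam) * zonal lam y n := by
  induction n using Nat.twoStepInduction with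
  | zero =>
    simp only [zonal, dirDeriv_C_mul, dirDeriv_linForm y hy, Nat.cast_zero, zero_add]
  | one =>
    refine eq_of_C_mul_eq (c := ((0 : ℕ) : ℝ) + 2) (by norm_num) ?_
    rw [← dirDeriv_C_mul, C_mul_zonal_add_two]
    have h1 : dirDeriv y (1 : MvPolynomial σ ℝ) = 0 := by simp [dirDeriv]
    simp only [zonal, dirDeriv_sub, dirDeriv_C_mul, dirDeriv_linForm_mul y hy,
      dirDeriv_linForm y hy, dirDeriv_normSqForm_mul, h1]
    simp only [map_add, map_mul, map_natCast, map_ofNat, map_one]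
    push_cast
    ring
  | more n h0 h1 =>
    refine eq_of_C_mul_eq (c := ((n + 1 : ℕ) : ℝ) + 2) (by positivity) ?_
    rw [← dirDeriv_C_mul, C_mul_zonal_add_two]
    have hrec := C_mul_zonal_add_two lam y n
    simp only [dirDeriv_sub, dirDeriv_C_mul, dirDeriv_linForm_mul y hy,
      dirDeriv_normSqForm_mul, h0, h1]
    simp only [map_add, map_mul, map_natCast, map_ofNat, map_one] at hrec ⊢
    push_cast
    -- The terms in degrees `n + 1` and `n` form `n + 1 + 2 * lam` times the recurrence for degree
    -- `n + 2`.
    linear_combination (-((n : MvPolynomial σ ℝ) + 1 + 2 * C lam)) * hrec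

/-- In the recurrence the two multiples of `zonal lam y n` cancel exactly when `4 * (n + 1 + lam) =
2 * card σ + 4 * n`, which is `hlam`. -/
theorem laplacian_zonal (lam : ℝ) (hlam : (Fintype.card σ : ℝ) = 2 * lam + 2) (y : σ → ℝ)
    (hy : ∑ i, y i * y i = 1) (n : ℕ) : laplacian (zonal lam y n) = 0 := by
  induction n using Nat.twoStepInduction with
  | zero => simp [zonal, laplacian]
  | one => simp [zonal, laplacian, pderiv_linForm]
  | more n h0 h1 =>
    rw [zonal, laplacian_C_mul, laplacian_sub, laplacian_C_mul, laplacian_C_mul,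
      laplacian_linForm_mul, laplacian_normSqForm_mul (isHomogeneous_zonal lam y n), h0, h1,
      dirDeriv_zonal lam y hy, hlam]
    simp only [map_add, map_mul, map_natCast, map_ofNat, map_one]
    ring

/-- Modulo `normSqForm` the recurrence only multiplies by `linForm y`. The constant `α` must not
depend on `y`, since it is factored out of a whole Gram matrix. -/
theorem exists_zonal_eq (lam : ℝ) (hlam : 0 < lam) (n : ℕ) :
    ∃ α : ℝ, 0 < α ∧ ∀ y : σ → ℝ, ∃ q : MvPolynomial σ ℝ,
      zonal lam y n = C α * linForm y ^ n + normSqForm σ * q := by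
  induction n with
  | zero => exact ⟨1, one_pos, fun y => ⟨0, by simp [zonal]⟩⟩
  | succ n ih =>
    obtain ⟨α, hα, h⟩ := ih
    match n with
    | 0 => exact ⟨2 * lam, by positivity, fun y => ⟨0, by simp [zonal]⟩⟩
    | n + 1 =>
      refine ⟨1 / ((n : ℝ) + 2) * (2 * ((n : ℝ) + 1 + lam)) * α, by positivity, fun y => ?_⟩
      obtain ⟨q, hq⟩ := h y
      refine ⟨C (1 / ((n : ℝ) + 2)) * (C (2 * ((n : ℝ) + 1 + lam)) * (linForm y * q) -
        C ((n : ℝ) + 2 * lam) * zonal lam y n), ?_⟩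
      rw [zonal, hq]
      simp only [C_mul]
      ring

/-- The Gram matrix of zonal polynomials in the Fischer inner product. -/
theorem exists_fischer_zonal (lam : ℝ) (hlam : 0 < lam) (hcard : (Fintype.card σ : ℝ) = 2 * lam + 2)
    (n : ℕ) : ∃ α : ℝ, 0 < α ∧ ∀ y z : σ → ℝ, ∑ i, y i * y i = 1 → ∑ i, z i * z i = 1 →
      fischer (zonal lam y n) (zonal lam z n) = α * (gegenbauer lam n).eval (∑ i, z i * y i) := by
  obtain ⟨α, hα, h⟩ := exists_zonal_eq (σ := σ) lam hlam n
  refine ⟨α * n.factorial, by positivity, fun y z hy hz => ?_⟩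
  obtain ⟨q, hq⟩ := h y
  -- Multiples of `normSqForm` are Fischer-orthogonal to harmonic polynomials, so only the power of
  -- `linForm y` contributes.
  rw [hq, map_add, LinearMap.add_apply, fischer_normSqForm_mul, laplacian_zonal lam hcard z hz,
    map_zero, add_zero, ← smul_eq_C_mul, map_smul, LinearMap.smul_apply,
    fischer_linForm_pow _ _ _ (isHomogeneous_zonal lam z n), eval_zonal lam y z hy, smul_eq_mul,
    mul_assoc]

end Zonal

theorem sum_mul_self_sphere {m : ℕ} (x : Sphere m) : ∑ i, x.1 i * x.1 i = 1 := by
  have h := EuclideanSpace.real_norm_sq_eq x.1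
  rw [norm_eq_of_mem_sphere x] at h
  simpa [pow_two] using h.symm

theorem dot_eq_sum {m : ℕ} (x y : Sphere m) : dot x y = ∑ i, x.1 i * y.1 i := by
  rw [dot, EuclideanSpace.inner_eq_star_dotProduct]
  simp [dotProduct, mul_comm]

theorem sphPoly_quadraticForm_nonneg {m : ℕ} (hm : 2 ≤ m) (l : ℕ) {n : ℕ} (z : Fin n → Sphere m)
    (c : Fin n → ℝ) : 0 ≤ ∑ μ, ∑ ν, c μ * c ν * (sphPoly m l).eval (dot (z μ) (z ν)) := by
  have hm' : (2 : ℝ) ≤ m := by exact_mod_cast hm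
  obtain ⟨α, hα, h⟩ := exists_fischer_zonal (σ := Fin (m + 1)) (((m : ℝ) - 1) / 2)
    (by linarith) (by simp; ring) l
  have key : fischer (∑ μ, c μ • zonal (((m : ℝ) - 1) / 2) (z μ).1 l)
      (∑ μ, c μ • zonal (((m : ℝ) - 1) / 2) (z μ).1 l) =
      α * ∑ μ, ∑ ν, c μ * c ν * (sphPoly m l).eval (dot (z μ) (z ν)) := by
    simp only [map_sum, LinearMap.sum_apply, map_smul, LinearMap.smul_apply, smul_eq_mul,
      Finset.mul_sum]
    refine Finset.sum_congr rfl fun μ _ => Finset.sum_congr rfl fun ν _ => ?_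
    rw [h _ _ (sum_mul_self_sphere _) (sum_mul_self_sphere _), sphPoly,
      if_neg (by omega : m ≠ 1), dot_eq_sum]
    ring
  exact nonneg_of_mul_nonneg_right (key ▸ fischer_self_nonneg _) hα

end SphereKernel

namespace SphereKernel

/-! ### Strict positive definiteness at repeated points -/

section Kernels

variable {X : Type*}

/-- Merging equal points adds their coefficients and keeps the quadratic form. This is needed
because distinct points of a product may share a coordinate. -/
theorem sum_fiber_eq_zero_of_isStrictPosDefKernel {K : X → X → ℝ} (hK : IsStrictPosDefKernel K)
    {n : ℕ} (x : Fin n → X) (c : Fin n → ℝ)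
    (h : ∑ μ, ∑ ν, c μ * c ν * K (x μ) (x ν) = 0) (w : X) [DecidablePred fun μ => x μ = w] :
    ∑ μ with x μ = w, c μ = 0 := by
  classical
  by_cases hw : ∃ μ, x μ = w
  swap
  · push Not at hw
    simp [Finset.filter_false_of_mem fun μ _ => hw μ]
  let s : Finset X := Finset.univ.image x
  let e := s.equivFin
  let b : X → ℝ := fun v => ∑ μ with x μ = v, c μ
  have hmem : ∀ μ, x μ ∈ s := fun μ => Finset.mem_image_of_mem x (Finset.mem_univ μ)
  have hfib : ∀ F : X → ℝ, ∑ μ, c μ * F (x μ) = ∑ j, b (e.symm j) * F (e.symm j) := by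
    intro F
    rw [Equiv.sum_comp e.symm (fun v : s => b v * F v), Finset.sum_coe_sort s (fun v => b v * F v),
      ← Finset.sum_fiberwise_of_maps_to (fun μ _ => hmem μ)]
    refine Finset.sum_congr rfl fun v _ => ?_
    rw [Finset.sum_mul]
    exact Finset.sum_congr rfl fun μ hμ => by rw [(Finset.mem_filter.mp hμ).2]
  have hsum : ∑ i, ∑ j, b (e.symm i) * b (e.symm j) * K (e.symm i) (e.symm j) = 0 := by
    rw [← h]
    simp only [mul_assoc, ← Finset.mul_sum]
    rw [hfib fun v => ∑ ν, c ν * K v (x ν)]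
    exact Finset.sum_congr rfl fun i _ => by rw [hfib fun u => K (e.symm i) u]
  by_contra hne
  obtain ⟨μ, rfl⟩ := hw
  refine (hK.2 s.card (fun j => (e.symm j : X)) (Subtype.val_injective.comp e.symm.injective)
    (fun j => b (e.symm j)) ⟨e ⟨x μ, hmem μ⟩, ?_⟩).ne' hsum
  simp only [Equiv.symm_apply_apply, b]
  convert hne

theorem dot_mem_Icc {m : ℕ} (x y : Sphere m) : dot x y ∈ Set.Icc (-1 : ℝ) 1 := by
  have h := abs_real_inner_le_norm (x : EuclideanSpace ℝ (Fin (m + 1)))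
    (y : EuclideanSpace ℝ (Fin (m + 1)))
  rw [norm_eq_of_mem_sphere x, norm_eq_of_mem_sphere y, mul_one] at h
  exact abs_le.mp h

theorem hasSum_quadraticForm {ι : Type*} {n : ℕ} (c : Fin n → ℝ) {F : ι → Fin n → Fin n → ℝ}
    {G : Fin n → Fin n → ℝ} (h : ∀ μ ν, HasSum (fun i => F i μ ν) (G μ ν)) :
    HasSum (fun i => ∑ μ, ∑ ν, c μ * c ν * F i μ ν) (∑ μ, ∑ ν, c μ * c ν * G μ ν) :=
  hasSum_sum fun μ _ => hasSum_sum fun ν _ => (h μ ν).mul_left _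

theorem sum_fiber_eq_zero_of_mem_SPD {m : ℕ} {I : Set ℕ} (hI : I ∈ SPD m) {n : ℕ}
    (x : Fin n → Sphere m) (c : Fin n → ℝ)
    (h : ∀ l ∈ I, ∑ μ, ∑ ν, c μ * c ν * (sphPoly m l).eval (dot (x μ) (x ν)) = 0) (w : Sphere m)
    [DecidablePred fun μ => x μ = w] :
    ∑ μ with x μ = w, c μ = 0 := by
  obtain ⟨g, a, -, hg, ⟨ha, -, hs⟩, rfl⟩ := hI
  refine sum_fiber_eq_zero_of_isStrictPosDefKernel hg x c ?_ w
  have key := hasSum_quadraticForm c fun μ ν => hs _ (dot_mem_Icc (x μ) (x ν))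
  have hz : ∀ l, ∑ μ, ∑ ν, c μ * c ν * (a l * (sphPoly m l).eval (dot (x μ) (x ν))) = 0 := by
    intro l
    rcases (ha l).eq_or_lt with h0 | h0
    · simp [← h0]
    · simp only [mul_left_comm _ (a l), ← Finset.mul_sum, h l h0, mul_zero]
  simp only [hz] at key
  exact key.unique hasSum_zero

end Kernels

/-! ### Trigonometric splitting on the circle -/

section Circle

theorem exists_angle (x : Sphere 1) : ∃ θ : ℝ, x.1 0 = Real.cos θ ∧ x.1 1 = Real.sin θ := by
  have h : x.1 0 ^ 2 + x.1 1 ^ 2 = 1 := by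
    have := EuclideanSpace.real_norm_sq_eq x.1
    rw [norm_eq_of_mem_sphere x] at this
    simpa [Fin.sum_univ_two] using this.symm
  have hn : ‖(⟨x.1 0, x.1 1⟩ : ℂ)‖ = 1 := by
    rw [Complex.norm_def, Complex.normSq_mk, Real.sqrt_eq_one]
    linarith
  refine ⟨Complex.arg ⟨x.1 0, x.1 1⟩, ?_, ?_⟩
  · simpa [hn] using (Complex.norm_mul_cos_arg ⟨x.1 0, x.1 1⟩).symm
  · simpa [hn] using (Complex.norm_mul_sin_arg ⟨x.1 0, x.1 1⟩).symm

theorem exists_pos_sphPoly_one_eval_cos (k : ℕ) :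
    ∃ β : ℝ, 0 < β ∧ ∀ θ, (sphPoly 1 k).eval (Real.cos θ) = β * Real.cos (k * θ) := by
  rcases Nat.eq_zero_or_pos k with rfl | hk
  · exact ⟨1, one_pos, fun θ => by simp [sphPoly]⟩
  · refine ⟨2 / k, by positivity, fun θ => ?_⟩
    simp [sphPoly, hk.ne', Polynomial.Chebyshev.T_real_cos]

/-- The zonal functions of the circle split into products of trigonometric functions. -/
theorem exists_circle_features (k : ℕ) : ∃ (β : ℝ) (u v : Sphere 1 → ℝ), 0 < β ∧
    ∀ x y, (sphPoly 1 k).eval (dot x y) = β * (u x * u y + v x * v y) := by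
  choose θ hc hs using exists_angle
  obtain ⟨β, hβ, h⟩ := exists_pos_sphPoly_one_eval_cos k
  refine ⟨β, fun x => Real.cos (k * θ x), fun x => Real.sin (k * θ x), hβ, fun x y => ?_⟩
  have hd : dot x y = Real.cos (θ x - θ y) := by
    rw [Real.cos_sub, ← hc, ← hs, ← hc, ← hs, dot, EuclideanSpace.inner_eq_star_dotProduct]
    simp [dotProduct, Fin.sum_univ_two, mul_comm]
  rw [hd, h, mul_sub, Real.cos_sub]

end Circle

end SphereKernel

/-! ### Strict positive definiteness on the product -/

open SphereKernel in
theorem theorem2p4 (m : ℕ) (hm : 2 ≤ m) (f : ℝ → ℝ → ℝ)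
    (hcont : ContinuousOn (Function.uncurry f) (Set.Icc (-1 : ℝ) 1 ×ˢ Set.Icc (-1 : ℝ) 1))
    (hpd : SphereKernel.IsPosDefKernel (SphereKernel.productKernel 1 m f))
    (a : ℕ → ℕ → ℝ) (ha : SphereKernel.IsSchoenbergDoubleSeries 1 m f a)
    (hSPD : {k : ℕ | {l : ℕ | 0 < a k l} ∈ SphereKernel.SPD m} ∈ SphereKernel.SPD 1) :
    SphereKernel.IsStrictPosDefKernel (SphereKernel.productKernel 1 m f) := by
  classical
  refine ⟨hpd, fun n p hp c ⟨μ₀, hμ₀⟩ => (hpd.2 n p hp c).lt_of_ne fun h0 => hμ₀ ?_⟩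
  obtain ⟨ha0, -, hsum⟩ := ha
  choose β u v hβ hP using exists_circle_features
  let Q : ℕ → (Fin n → ℝ) → ℝ := fun l b =>
    ∑ μ, ∑ ν, b μ * b ν * (sphPoly m l).eval (dot (p μ).2 (p ν).2)
  have hQ : ∀ l b, 0 ≤ Q l b := fun l b => sphPoly_quadraticForm_nonneg hm l (fun μ => (p μ).2) b
  let U : ℕ → Fin n → ℝ := fun k μ => c μ * u k (p μ).1
  let V : ℕ → Fin n → ℝ := fun k μ => c μ * v k (p μ).1
  have hterm : ∀ k l, ∑ μ, ∑ ν, c μ * c ν * (a k l * (sphPoly 1 k).eval (dot (p μ).1 (p ν).1) *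
      (sphPoly m l).eval (dot (p μ).2 (p ν).2)) = a k l * β k * (Q l (U k) + Q l (V k)) := by
    intro k l
    simp only [Q, U, V, ← Finset.sum_add_distrib, Finset.mul_sum, hP]
    exact Finset.sum_congr rfl fun μ _ => Finset.sum_congr rfl fun ν _ => by ring
  have hs := hasSum_quadraticForm c fun μ ν => hsum _ (dot_mem_Icc (p μ).1 (p ν).1) _
    (dot_mem_Icc (p μ).2 (p ν).2)
  simp only [hterm] at hs
  have hs0 : HasSum (fun i : ℕ × ℕ => a i.1 i.2 * β i.1 * (Q i.2 (U i.1) + Q i.2 (V i.1))) 0 := by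
    convert hs using 1
    exact h0
  have hzero := (hasSum_zero_iff_of_nonneg fun i : ℕ × ℕ =>
    mul_nonneg (mul_nonneg (ha0 i.1 i.2) (hβ i.1).le) (add_nonneg (hQ _ _) (hQ _ _))).mp hs0
  have hUV : ∀ k l, 0 < a k l → Q l (U k) = 0 ∧ Q l (V k) = 0 := by
    intro k l hkl
    have h := (mul_eq_zero.mp (congrFun hzero (k, l))).resolve_left
      (mul_pos hkl (hβ k)).ne'
    exact (add_eq_zero_iff_of_nonneg (hQ _ _) (hQ _ _)).mp h
  -- Restricting `c` to the fiber of `z` through `μ₀` turns the fiber sums on `S^m` into full sums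
  -- on the circle.
  let c' : Fin n → ℝ := fun μ => if (p μ).2 = (p μ₀).2 then c μ else 0
  have hfib : ∀ k, {l : ℕ | 0 < a k l} ∈ SPD m →
      ∑ μ, c' μ * u k (p μ).1 = 0 ∧ ∑ μ, c' μ * v k (p μ).1 = 0 := by
    intro k hk
    have hU := sum_fiber_eq_zero_of_mem_SPD hk (fun μ => (p μ).2) (U k)
      (fun l hl => (hUV k l hl).1) (p μ₀).2
    have hV := sum_fiber_eq_zero_of_mem_SPD hk (fun μ => (p μ).2) (V k)
      (fun l hl => (hUV k l hl).2) (p μ₀).2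
    rw [Finset.sum_filter] at hU hV
    simp only [c', ite_mul, zero_mul]
    exact ⟨hU, hV⟩
  have hfin := sum_fiber_eq_zero_of_mem_SPD hSPD (fun μ => (p μ).1) c' (fun k hk => by
    obtain ⟨hu, hv⟩ := hfib k hk
    -- The circle form is `β k` times a sum of two squares, both zero by `hfib`.
    have h : ∑ μ, ∑ ν, c' μ * c' ν * (sphPoly 1 k).eval (dot (p μ).1 (p ν).1) =
        β k * ((∑ μ, c' μ * u k (p μ).1) * ∑ ν, c' ν * u k (p ν).1) +
        β k * ((∑ μ, c' μ * v k (p μ).1) * ∑ ν, c' ν * v k (p ν).1) := by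
      rw [Finset.sum_mul_sum, Finset.sum_mul_sum]
      simp only [Finset.mul_sum, ← Finset.sum_add_distrib, hP]
      exact Finset.sum_congr rfl fun μ _ => Finset.sum_congr rfl fun ν _ => by ring
    rw [h, hu, hv, mul_zero, mul_zero, add_zero]) (p μ₀).1
  -- Since the pairs are distinct, only `μ₀` has both coordinates of `p μ₀`.
  rw [Finset.sum_filter, Finset.sum_eq_single μ₀] at hfin
  · simpa [c'] using hfin
  · intro μ _ hne
    by_cases h1 : (p μ).1 = (p μ₀).1
    · have h2 : (p μ).2 ≠ (p μ₀).2 := fun h2 => hne (hp (Prod.ext h1 h2))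
      simp [c', h2]
    · simp [h1]
  · simp
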